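/- An $M\times N$ real matrix $\Phi$ satisfies the $(K,\delta)$-restricted isometry property if $(1-\delta)\|x\|_2^2\le\|\Phi x\|_2^2\le(1+\delta)\|x\|_2^2$ for every $x\in\mathbb{R}^N$ with at most $K$ nonzero entries. A finite family $(X_i)_i$ of random variables with values in $\{\pm1\}$ (Bernoulli random variables, not assumed independent or of mean zero) is called $\varepsilon$-biased if $\bigl|\mathbb{E}\prod_{i\in I}X_i\bigr|\le\varepsilon$ for every nonempty set $I$ of indices. Below, $\log$ is the natural logarithm. **Theorem.** Fix $C=5760000$. There exists $N_0$ for which the following holds. Given integers $N\ge N_0$ and $K\ge 2$ and a real number $0<\delta\le 1$, take $$M=\Bigl\lceil (C/\delta^2)\,K\log^2 K\,\log N\Bigr\rceil$$ and pick any $$\varepsilon\le\exp\Bigl(-40K\log\bigl((150/\delta)K\log K\bigr)\log N\Bigr).$$ Then any random $M\times N$ matrix $\Phi=\frac{1}{\sqrt M}(X_{m,n})$ whose $MN$ unscaled entries $X_{m,n}$ are $\varepsilon$-biased Bernoulli $\pm1$ random variables satisfies the $(2K,\delta)$-restricted isometry property with probability at least $1-2N^{-2K}$. The threshold $N_0$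 is absolute: it does not depend on $K$, $\delta$, $\varepsilon$ or the distribution of the entries. -/

import Mathlib

open MeasureTheory

/-- The `(K, δ)`-restricted isometry property of a real `M × N` matrix, in the Euclidean norm:
`(1 - δ)‖x‖² ≤ ‖Φ x‖² ≤ (1 + δ)‖x‖²` for every `x` with at most `K` nonzero entries. -/
def HasRIP {M N : ℕ} (Φ : Matrix (Fin M) (Fin N) ℝ) (K : ℕ) (δ : ℝ) : Prop :=
  ∀ x : EuclideanSpace ℝ (Fin N), {j | x j ≠ 0}.ncard ≤ K →
    (1 - δ) * ‖x‖ ^ 2 ≤ ‖WithLp.toLp 2 (Φ.mulVec x.ofLp)‖ ^ 2 ∧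
      ‖WithLp.toLp 2 (Φ.mulVec x.ofLp)‖ ^ 2 ≤ (1 + δ) * ‖x‖ ^ 2

/-- A family of Bernoulli random variables: measurable and with values in `{1, -1}`.
Neither independence nor mean zero is required. -/
structure IsBernoulliFamily {Ω ι : Type*} [MeasurableSpace Ω] (X : ι → Ω → ℝ) : Prop where
  measurable : ∀ i, Measurable (X i)
  eq_one_or_neg_one : ∀ i ω, X i ω = 1 ∨ X i ω = -1

/-- `ε`-biased family: `|𝔼 ∏_{i ∈ I} X i| ≤ ε` for every nonempty finite set `I` of indices. -/
def IsBiased {Ω ι : Type*} [MeasurableSpace Ω] (μ : Measure Ω) (ε : ℝ) (X : ι → Ω → ℝ) : Prop :=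
  ∀ I : Finset ι, I.Nonempty → |∫ ω, ∏ i ∈ I, X i ω ∂μ| ≤ ε

/-- The matrix `Φ[m, n] = X (m, n) / √M` at the outcome `ω`. -/
noncomputable def scaledMatrix {Ω : Type*} {M N : ℕ} (X : Fin M × Fin N → Ω → ℝ) (ω : Ω) :
    Matrix (Fin M) (Fin N) ℝ :=
  Matrix.of fun m n => X (m, n) ω / √(M : ℝ)

/-!
The proof is a union bound over a net, with the tail of each net vector controlled by a high
moment; only the moments involve the joint law of the entries, and small bias determines them up to
a small error.

*One vector.* For a vector `y`, the quantity `M (‖Φ y‖² - ‖y‖²)` is the chaos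
`W = ∑ₘ ((∑ₙ yₙ Xₘₙ)² - ∑ₙ yₙ²)`. Since `Xₘₙ² = 1`, its `p`-th power is a combination of products of
distinct entries with absolute coefficient sum at most `(M ‖y‖₁²) ^ p ≤ (2 K M) ^ p` for a
`2K`-sparse `y` in the unit ball, so `𝔼 W ^ p` differs by at most `ε (2 K M) ^ p` from its value for
independent uniform signs (`integral_pow_le_expect_pow_add`). For independent signs the rows are
independent, and averaging out one sign at a time yields `𝔼 exp (t W) ≤ exp (8 t² M)` for
`|t| ≤ 1 / 8` (`expect_exp_sq_le`, `expect_exp_chaos_le`), hence a bound on `𝔼 W ^ p`. Markov's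
inequality with `p ≈ 10 K log N` and `t = 6 p / (δ M)` shows that `|W| ≥ M δ / 2` with probability
at most `3 N ^ (-9 K)` (`measureReal_le_abs_chaos_le`, `moment_bound_le`).

*The net.* Choosing a support already costs a factor `N ^ (2 K)` in the union bound, so a crude
net is affordable: the `2K`-sparse vectors of the unit ball with coordinates in `ℤ / N`, at most
`N ^ (6 K)` in number (`card_sparseGrid_le`). Rounding towards zero moves a vector of the unit ball
by at most `1 / √N ≤ 1 / 8` and keeps its support, so a bound `δ / 2` on the grid gives the
restricted isometry property with constant `δ` (`hasRIP_of_sparseGrid`).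
-/

/-! ### Polynomials in signs and biased families -/

section SignCube

open Finset

variable {ι : Type*}

/-- A product of two characters of the sign cube is the character of the symmetric difference. -/
lemma prod_mul_prod_eq_prod_symmDiff [DecidableEq ι] {x : ι → ℝ} (hx : ∀ i, x i = 1 ∨ x i = -1)
    (I J : Finset ι) :
    (∏ i ∈ I, x i) * ∏ i ∈ J, x i = ∏ i ∈ symmDiff I J, x i := by
  have hsq : (∏ i ∈ I ∩ J, x i) * ∏ i ∈ I ∩ J, x i = 1 := by
    rw [← prod_mul_distrib]
    refine prod_eq_one fun i _ => ?_
    rcases hx i with h | h <;> rw [h] <;> norm_num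
  have hdisj : Disjoint (I \ J) (J \ I) := disjoint_sdiff_sdiff
  have hJ := prod_inter_mul_prod_sdiff J I x
  rw [inter_comm] at hJ
  rw [symmDiff_def, sup_eq_union, prod_union hdisj, ← prod_inter_mul_prod_sdiff I J x, ← hJ]
  linear_combination ((∏ i ∈ I \ J, x i) * ∏ i ∈ J \ I, x i) * hsq

lemma exists_prod_prod_eq_prod [DecidableEq ι] {κ : Type*} (s : Finset κ) (I : κ → Finset ι) :
    ∃ J : Finset ι, ∀ x : ι → ℝ, (∀ i, x i = 1 ∨ x i = -1) →
      ∏ k ∈ s, ∏ i ∈ I k, x i = ∏ i ∈ J, x i := by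
  classical
  induction s using Finset.induction_on with
  | empty => exact ⟨∅, fun x _ => by simp⟩
  | insert a s ha ih =>
    obtain ⟨J, hJ⟩ := ih
    refine ⟨symmDiff (I a) J, fun x hx => ?_⟩
    rw [prod_insert ha, hJ x hx, prod_mul_prod_eq_prod_symmDiff hx]

/-- The real sign vector of a point of the cube `{1, -1}^ι`. -/
def signVec (r : ι → ℤˣ) (i : ι) : ℝ := ((r i : ℤ) : ℝ)

lemma signVec_eq_one_or (r : ι → ℤˣ) (i : ι) : signVec r i = 1 ∨ signVec r i = -1 := by
  unfold signVec
  rcases Int.units_eq_one_or (r i) with h | h <;> simp [h]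

variable [DecidableEq ι]

lemma signVec_flip_self (r : ι → ℤˣ) (a : ι) :
    signVec (r * Pi.mulSingle a (-1)) a = -signVec r a := by
  simp [signVec]

lemma signVec_flip_of_ne (r : ι → ℤˣ) {a i : ι} (h : i ≠ a) :
    signVec (r * Pi.mulSingle a (-1)) i = signVec r i := by
  simp [signVec, h]

variable [Fintype ι]

lemma expect_flip (a : ι) (F : (ι → ℤˣ) → ℝ) :
    univ.expect (fun r : ι → ℤˣ => F (r * Pi.mulSingle a (-1))) = univ.expect F :=
  Fintype.expect_equiv (Equiv.mulRight (Pi.mulSingle a (-1))) _ _ fun _ => rfl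

lemma expect_prod_signVec {I : Finset ι} (hI : I.Nonempty) :
    univ.expect (fun r : ι → ℤˣ => ∏ i ∈ I, signVec r i) = 0 := by
  obtain ⟨a, ha⟩ := hI
  have h := expect_flip a fun r : ι → ℤˣ => ∏ i ∈ I, signVec r i
  have hneg : ∀ r : ι → ℤˣ, ∏ i ∈ I, signVec (r * Pi.mulSingle a (-1)) i =
      -∏ i ∈ I, signVec r i := by
    intro r
    rw [← mul_prod_erase I _ ha, ← mul_prod_erase I (signVec r) ha, signVec_flip_self, neg_mul,
      prod_congr rfl fun i hi => signVec_flip_of_ne r (ne_of_mem_erase hi)]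
  simp only [hneg, expect_neg_distrib] at h
  linarith

/-- Square-exponential moment of a Rademacher sum with `∑ yᵢ² = σ`, for `t` of either sign.
Averaging out one sign replaces `t` by `t + 2 t² yᵢ²`, because `cosh x ≤ exp (x² / 2)`. -/
lemma expect_exp_sq_le (y : ι → ℝ) (s : Finset ι) :
    ∀ t : ℝ, 8 * |t| * ∑ i ∈ s, y i ^ 2 ≤ 1 →
      univ.expect (fun r : ι → ℤˣ => Real.exp (t * (∑ i ∈ s, y i * signVec r i) ^ 2)) ≤
        Real.exp (t * ∑ i ∈ s, y i ^ 2 + 8 * t ^ 2 * (∑ i ∈ s, y i ^ 2) ^ 2) := by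
  induction s using Finset.induction_on with
  | empty => intro t _; simp
  | insert a s ha ih =>
    intro t ht
    rw [sum_insert ha] at ht ⊢
    have hσ : 0 ≤ ∑ i ∈ s, y i ^ 2 := sum_nonneg fun i _ => sq_nonneg _
    set σ := ∑ i ∈ s, y i ^ 2
    set v := y a ^ 2 with hv
    have hv0 : 0 ≤ v := sq_nonneg _
    set S : (ι → ℤˣ) → ℝ := fun r => ∑ i ∈ s, y i * signVec r i with hS
    have hflip : ∀ r : ι → ℤˣ, S (r * Pi.mulSingle a (-1)) = S r := fun r =>
      sum_congr rfl fun i hi => by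
        rw [signVec_flip_of_ne r (ne_of_mem_of_not_mem hi ha)]
    -- Adding the value at `r` and at `r` with its `a`-th sign flipped gives a hyperbolic cosine.
    have key : ∀ r : ι → ℤˣ,
        Real.exp (t * (y a * signVec r a + S r) ^ 2) +
          Real.exp (t * (y a * signVec (r * Pi.mulSingle a (-1)) a +
            S (r * Pi.mulSingle a (-1))) ^ 2) ≤
        2 * (Real.exp (t * v) * Real.exp ((t + 2 * t ^ 2 * v) * S r ^ 2)) := by
      intro r
      rw [signVec_flip_self, hflip]
      have hs : signVec r a ^ 2 = 1 := by
        rcases signVec_eq_one_or r a with h | h <;> rw [h] <;> norm_num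
      set e := signVec r a
      have h1 : t * (y a * e + S r) ^ 2 = t * v + t * S r ^ 2 + 2 * t * S r * y a * e := by
        rw [hv]; linear_combination t * y a ^ 2 * hs
      have h2 : t * (y a * -e + S r) ^ 2 = t * v + t * S r ^ 2 + -(2 * t * S r * y a * e) := by
        rw [hv]; linear_combination t * y a ^ 2 * hs
      have hc := Real.cosh_le_exp_half_sq (2 * t * S r * y a * e)
      have h3 : (2 * t * S r * y a * e) ^ 2 / 2 = 2 * t ^ 2 * v * S r ^ 2 := by
        rw [hv]; linear_combination 2 * t ^ 2 * S r ^ 2 * y a ^ 2 * hs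
      rw [h3, Real.cosh_eq] at hc
      have h4 : (t + 2 * t ^ 2 * v) * S r ^ 2 = t * S r ^ 2 + 2 * t ^ 2 * v * S r ^ 2 := by ring
      rw [h1, h2, h4, Real.exp_add, Real.exp_add (t * v + t * S r ^ 2), Real.exp_add (t * v),
        Real.exp_add (t * S r ^ 2)]
      nlinarith [mul_le_mul_of_nonneg_left hc
        (mul_pos (Real.exp_pos (t * v)) (Real.exp_pos (t * S r ^ 2))).le]
    have hsum := expect_le_expect (s := univ) fun r _ => key r
    rw [expect_add_distrib, expect_flip a fun r : ι → ℤˣ =>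
      Real.exp (t * (y a * signVec r a + S r) ^ 2), ← mul_expect, ← mul_expect] at hsum
    have hta : 0 ≤ |t| := abs_nonneg t
    have htt : t ^ 2 = |t| ^ 2 := (sq_abs t).symm
    have htle : t ≤ |t| := le_abs_self t
    have htv : |t| * v ≤ 1 / 8 := by nlinarith [mul_nonneg hta hσ]
    have htσ : |t| * σ ≤ 1 / 8 := by nlinarith [mul_nonneg hta hv0]
    have habs : |t + 2 * t ^ 2 * v| ≤ |t| * (1 + 2 * (|t| * v)) := by
      refine (abs_add_le _ _).trans (le_of_eq ?_)
      rw [abs_of_nonneg (by positivity : (0:ℝ) ≤ 2 * t ^ 2 * v), htt]; ring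
    have hcond : 8 * |t + 2 * t ^ 2 * v| * σ ≤ 1 := by
      have h1 := mul_le_mul_of_nonneg_right habs hσ
      nlinarith [mul_nonneg (mul_nonneg hta hv0) (sub_nonneg.2 htσ)]
    have hih := ih _ hcond
    have hbound : t * v + ((t + 2 * t ^ 2 * v) * σ + 8 * (t + 2 * t ^ 2 * v) ^ 2 * σ ^ 2) ≤
        t * (v + σ) + 8 * t ^ 2 * (v + σ) ^ 2 := by
      have htv' : t * v ≤ 1 / 8 := (mul_le_mul_of_nonneg_right htle hv0).trans htv
      have htσ' : t * σ ≤ 1 / 8 := (mul_le_mul_of_nonneg_right htle hσ).trans htσ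
      have htσ2 : (t * σ) ^ 2 ≤ 1 / 64 := by
        rw [mul_pow, htt, ← mul_pow]; nlinarith [mul_nonneg hta hσ]
      have e : t * (v + σ) + 8 * t ^ 2 * (v + σ) ^ 2 -
          (t * v + ((t + 2 * t ^ 2 * v) * σ + 8 * (t + 2 * t ^ 2 * v) ^ 2 * σ ^ 2)) =
          t ^ 2 * (σ * v * (14 - 32 * (t * σ)) + v ^ 2 * (8 - 32 * (t * σ) ^ 2)) := by ring
      have : 0 ≤ t ^ 2 * (σ * v * (14 - 32 * (t * σ)) + v ^ 2 * (8 - 32 * (t * σ) ^ 2)) := by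
        have h1 : 0 ≤ 14 - 32 * (t * σ) := by linarith
        have h2 : 0 ≤ 8 - 32 * (t * σ) ^ 2 := by linarith
        positivity
      linarith
    calc _ = univ.expect (fun r : ι → ℤˣ => Real.exp (t * (y a * signVec r a + S r) ^ 2)) := by
            simp only [sum_insert ha, hS]
      _ ≤ Real.exp (t * v) *
          univ.expect (fun r : ι → ℤˣ => Real.exp ((t + 2 * t ^ 2 * v) * S r ^ 2)) := by linarith
      _ ≤ Real.exp (t * v) * Real.exp ((t + 2 * t ^ 2 * v) * σ +
          8 * (t + 2 * t ^ 2 * v) ^ 2 * σ ^ 2) := by gcongr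
      _ ≤ _ := by rw [← Real.exp_add]; exact Real.exp_le_exp.2 hbound

/-- On polynomials in signs given by coefficients `a` and monomials `I`, the `p`-th moment under an
`ε`-biased family is that under independent uniform signs, up to `ε (∑ |a|) ^ p`. -/
lemma integral_pow_le_expect_pow_add {Ω : Type*} [MeasurableSpace Ω] {μ : Measure Ω}
    [IsProbabilityMeasure μ] {X : ι → Ω → ℝ} {ε : ℝ} (hX : IsBernoulliFamily X)
    (hε : 0 ≤ ε) (hb : IsBiased μ ε X) {τ : Type*} [Fintype τ] (a : τ → ℝ) (I : τ → Finset ι)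
    (p : ℕ) :
    ∫ ω, (∑ t, a t * ∏ i ∈ I t, X i ω) ^ p ∂μ ≤
      univ.expect (fun r : ι → ℤˣ => (∑ t, a t * ∏ i ∈ I t, signVec r i) ^ p) +
        ε * (∑ t, |a t|) ^ p := by
  choose J hJ using fun φ : Fin p → τ => exists_prod_prod_eq_prod univ fun k => I (φ k)
  have hexp : ∀ x : ι → ℝ, (∀ i, x i = 1 ∨ x i = -1) →
      (∑ t, a t * ∏ i ∈ I t, x i) ^ p =
        ∑ φ : Fin p → τ, (∏ k, a (φ k)) * ∏ i ∈ J φ, x i := by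
    intro x hx
    rw [Fintype.sum_pow]
    refine sum_congr rfl fun φ _ => ?_
    rw [prod_mul_distrib, hJ φ x hx]
  have hint : ∀ K : Finset ι, Integrable (fun ω => ∏ i ∈ K, X i ω) μ := by
    intro K
    refine Integrable.of_bound (C := 1)
      (Finset.measurable_prod K fun i _ => hX.measurable i).aestronglyMeasurable
      (Filter.Eventually.of_forall fun ω => ?_)
    rw [Real.norm_eq_abs, abs_prod]
    refine le_of_eq (prod_eq_one fun i _ => ?_)
    rcases hX.eq_one_or_neg_one i ω with h | h <;> rw [h] <;> norm_num
  have hterm : ∀ φ : Fin p → τ, (∏ k, a (φ k)) * ∫ ω, ∏ i ∈ J φ, X i ω ∂μ ≤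
      (∏ k, a (φ k)) * univ.expect (fun r : ι → ℤˣ => ∏ i ∈ J φ, signVec r i) +
        ε * ∏ k, |a (φ k)| := by
    intro φ
    rw [← abs_prod]
    rcases (J φ).eq_empty_or_nonempty with h | h
    · simp only [h, prod_empty, integral_const, probReal_univ, smul_eq_mul, mul_one,
        expect_const univ_nonempty]
      have := mul_nonneg hε (abs_nonneg (∏ k, a (φ k)))
      linarith
    · rw [expect_prod_signVec h, mul_zero, zero_add, mul_comm ε]
      refine (le_abs_self _).trans ?_
      rw [abs_mul]
      exact mul_le_mul_of_nonneg_left (hb _ h) (abs_nonneg _)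
  calc ∫ ω, (∑ t, a t * ∏ i ∈ I t, X i ω) ^ p ∂μ
      = ∑ φ : Fin p → τ, (∏ k, a (φ k)) * ∫ ω, ∏ i ∈ J φ, X i ω ∂μ := by
        simp_rw [fun ω => hexp (fun i => X i ω) fun i => hX.eq_one_or_neg_one i ω]
        rw [integral_finsetSum _ fun φ _ => (hint _).const_mul _]
        simp_rw [integral_const_mul]
    _ ≤ _ := sum_le_sum fun φ _ => hterm φ
    _ = _ := by
        rw [sum_add_distrib, ← mul_sum, ← Fintype.sum_pow fun t => |a t|]
        simp_rw [fun r : ι → ℤˣ => hexp (signVec r) (signVec_eq_one_or r), expect_sum_comm,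
          ← mul_expect]

end SignCube

/-! ### The chaos of a vector -/

section Chaos

open Finset

variable {κ ι : Type*} [Fintype κ] [Fintype ι]

/-- The chaos `∑ₘ ((∑ₙ yₙ xₘₙ)² - ∑ₙ yₙ²)`. It equals `M (‖Φ y‖² - ‖y‖²)` for `Φ = x / √M`, where
`M` is the number of rows; for signs `x` its diagonal terms `yₙ² xₘₙ² - yₙ²` vanish. -/
def chaos (y : ι → ℝ) (x : κ × ι → ℝ) : ℝ :=
  ∑ m, ((∑ n, y n * x (m, n)) ^ 2 - ∑ n, y n ^ 2)

/-- The coefficients of the off-diagonal expansion of `chaos y`. -/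
def chaosCoeff [DecidableEq ι] (y : ι → ℝ) (q : κ × ι × ι) : ℝ :=
  if q.2.1 = q.2.2 then 0 else y q.2.1 * y q.2.2

lemma chaos_eq_sum [DecidableEq κ] [DecidableEq ι] (y : ι → ℝ) {x : κ × ι → ℝ}
    (hx : ∀ i, x i = 1 ∨ x i = -1) :
    chaos y x = ∑ q : κ × ι × ι, chaosCoeff y q *
      ∏ i ∈ ({(q.1, q.2.1), (q.1, q.2.2)} : Finset (κ × ι)), x i := by
  have hterm : ∀ (m : κ) (n n' : ι), chaosCoeff y (m, n, n') *
      ∏ i ∈ ({(m, n), (m, n')} : Finset (κ × ι)), x i =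
        y n * x (m, n) * (y n' * x (m, n')) - if n = n' then y n ^ 2 else 0 := by
    intro m n n'
    by_cases h : n = n'
    · subst h
      have : x (m, n) ^ 2 = 1 := by rcases hx (m, n) with h | h <;> rw [h] <;> norm_num
      simp only [chaosCoeff, if_true, zero_mul]
      linear_combination -y n ^ 2 * this
    · rw [prod_pair (by simp [h])]
      simp only [chaosCoeff, if_neg h]
      ring
  rw [chaos, Fintype.sum_prod_type]
  refine sum_congr rfl fun m _ => ?_
  rw [Fintype.sum_prod_type]
  simp_rw [hterm, sum_sub_distrib, sq (∑ n, y n * x (m, n)), sum_mul_sum]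
  simp

lemma sum_abs_chaosCoeff_le [DecidableEq ι] (y : ι → ℝ) :
    ∑ q : κ × ι × ι, |chaosCoeff y q| ≤ Fintype.card κ * (∑ n, |y n|) ^ 2 := by
  calc ∑ q : κ × ι × ι, |chaosCoeff y q| ≤ ∑ q : κ × ι × ι, |y q.2.1| * |y q.2.2| := by
        refine sum_le_sum fun q _ => ?_
        unfold chaosCoeff
        split_ifs
        · rw [abs_zero]; positivity
        · rw [abs_mul]
    _ = _ := by
        rw [Fintype.sum_prod_type]
        simp [Fintype.sum_prod_type, sq, sum_mul_sum]

lemma measurable_chaos {Ω : Type*} [MeasurableSpace Ω] {X : κ × ι → Ω → ℝ}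
    (hX : IsBernoulliFamily X) (y : ι → ℝ) : Measurable fun ω => chaos y fun i => X i ω := by
  have := hX.measurable
  unfold chaos
  fun_prop

variable [DecidableEq κ] [DecidableEq ι]

/-- Averages of products over independent rows factor. -/
lemma expect_prod_rows {A : Type*} [Fintype A] [Nonempty A] (g : A → ℝ) :
    univ.expect (fun R : κ → A => ∏ m, g (R m)) = (univ.expect g) ^ Fintype.card κ := by
  rw [Fintype.expect_eq_sum_div_card, Fintype.expect_eq_sum_div_card, div_pow, Fintype.card_fun,
    Nat.cast_pow, ← Fintype.piFinset_univ, ← prod_univ_sum, prod_const, card_univ]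

lemma expect_exp_chaos_le (y : ι → ℝ) {t : ℝ} (ht : 8 * |t| * ∑ n, y n ^ 2 ≤ 1) :
    univ.expect (fun r : κ × ι → ℤˣ => Real.exp (t * chaos y (signVec r))) ≤
      Real.exp (8 * t ^ 2 * (∑ n, y n ^ 2) ^ 2 * Fintype.card κ) := by
  set σ := ∑ n, y n ^ 2
  set g : (ι → ℤˣ) → ℝ := fun s =>
    Real.exp (-(t * σ)) * Real.exp (t * (∑ n, y n * signVec s n) ^ 2) with hg
  have h1 : univ.expect (fun r : κ × ι → ℤˣ => Real.exp (t * chaos y (signVec r))) =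
      univ.expect (fun R : κ → ι → ℤˣ => ∏ m, g (R m)) := by
    refine Fintype.expect_equiv (Equiv.curry κ ι ℤˣ) _ _ fun r => ?_
    rw [chaos, mul_sum, Real.exp_sum]
    refine prod_congr rfl fun m _ => ?_
    simp only [hg]
    rw [← Real.exp_add]
    congr 1
    simp only [signVec, Equiv.curry_apply, Function.curry]
    ring
  rw [h1, expect_prod_rows, mul_comm _ (Fintype.card κ : ℝ), Real.exp_nat_mul]
  refine pow_le_pow_left₀ (expect_nonneg fun s _ => by positivity) ?_ _
  rw [← mul_expect]
  calc _ ≤ Real.exp (-(t * σ)) * Real.exp (t * σ + 8 * t ^ 2 * σ ^ 2) := by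
        gcongr; exact expect_exp_sq_le y univ t ht
    _ = _ := by rw [← Real.exp_add]; congr 1; ring

lemma expect_chaos_pow_le (y : ι → ℝ) (hy : ∑ n, y n ^ 2 ≤ 1) {t : ℝ} (ht : 0 < t)
    (ht8 : t ≤ 1 / 8) {p : ℕ} (hp : Even p) :
    univ.expect (fun r : κ × ι → ℤˣ => chaos y (signVec r) ^ p) ≤
      (p / t) ^ p * (2 * Real.exp (8 * t ^ 2 * Fintype.card κ)) := by
  have hσ : 0 ≤ ∑ n, y n ^ 2 := sum_nonneg fun i _ => sq_nonneg _
  have hσ2 : (∑ n, y n ^ 2) ^ 2 ≤ 1 := pow_le_one₀ hσ hy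
  -- From `(t |w|) ^ p / p! ≤ exp (t |w|)` and `p! ≤ p ^ p`.
  have hpt : ∀ w : ℝ, w ^ p ≤ (p / t) ^ p * (Real.exp (t * w) + Real.exp (-t * w)) := by
    intro w
    have h1 := Real.pow_div_factorial_le_exp (t * |w|) (by positivity) p
    have h2 : Real.exp (t * |w|) ≤ Real.exp (t * w) + Real.exp (-t * w) := by
      rcases abs_choice w with h | h <;> rw [h]
      · linarith [Real.exp_pos (-t * w)]
      · rw [mul_neg, ← neg_mul]; linarith [Real.exp_pos (t * w)]
    have h3 : (p.factorial : ℝ) ≤ (p : ℝ) ^ p := by exact_mod_cast Nat.factorial_le_pow p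
    rw [div_le_iff₀ (by positivity), mul_pow, hp.pow_abs] at h1
    rw [div_pow, div_mul_eq_mul_div, le_div_iff₀ (by positivity), mul_comm (w ^ p)]
    refine h1.trans ?_
    rw [mul_comm]
    gcongr
  have hcard : ∀ s : ℝ, |s| = t →
      univ.expect (fun r : κ × ι → ℤˣ => Real.exp (s * chaos y (signVec r))) ≤
        Real.exp (8 * t ^ 2 * Fintype.card κ) := by
    intro s hs
    refine (expect_exp_chaos_le y (by rw [hs]; nlinarith)).trans (Real.exp_le_exp.2 ?_)
    have hst : s ^ 2 = t ^ 2 := by rw [← hs, sq_abs]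
    rw [hst]
    exact mul_le_mul_of_nonneg_right (mul_le_of_le_one_right (by positivity) hσ2)
      (Nat.cast_nonneg _)
  calc _ ≤ univ.expect (fun r : κ × ι → ℤˣ => (p / t) ^ p *
          (Real.exp (t * chaos y (signVec r)) + Real.exp (-t * chaos y (signVec r)))) :=
        expect_le_expect fun r _ => hpt _
    _ ≤ _ := by
        rw [← mul_expect, expect_add_distrib]
        gcongr
        linarith [hcard t (abs_of_pos ht), hcard (-t) (by rw [abs_neg, abs_of_pos ht])]

/-- Markov's inequality for the `p`-th moment of the chaos of an `ε`-biased family. -/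
lemma measureReal_le_abs_chaos_le {Ω : Type*} [MeasurableSpace Ω] {μ : Measure Ω}
    [IsProbabilityMeasure μ] {X : κ × ι → Ω → ℝ} {ε : ℝ} (hX : IsBernoulliFamily X) (hε : 0 ≤ ε)
    (hb : IsBiased μ ε X) (y : ι → ℝ) (hy : ∑ n, y n ^ 2 ≤ 1) {t : ℝ} (ht : 0 < t)
    (ht8 : t ≤ 1 / 8) {p : ℕ} (hp : Even p) {D : ℝ} (hD : (∑ n, |y n|) ^ 2 ≤ D) {a : ℝ}
    (ha : 0 < a) :
    μ.real {ω | a ≤ |chaos y fun i => X i ω|} ≤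
      (p / (t * a)) ^ p * (2 * Real.exp (8 * t ^ 2 * Fintype.card κ)) +
        ε * (Fintype.card κ * D / a) ^ p := by
  have hmom : ∫ ω, (chaos y fun i => X i ω) ^ p ∂μ ≤
      (p / t) ^ p * (2 * Real.exp (8 * t ^ 2 * Fintype.card κ)) +
        ε * (Fintype.card κ * D) ^ p := by
    have h := integral_pow_le_expect_pow_add hX hε hb (chaosCoeff (κ := κ) y)
      (fun q => {(q.1, q.2.1), (q.1, q.2.2)}) p
    simp_rw [fun ω => (chaos_eq_sum y fun i => hX.eq_one_or_neg_one i ω).symm,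
      fun r : κ × ι → ℤˣ => (chaos_eq_sum y (signVec_eq_one_or r)).symm] at h
    refine h.trans (add_le_add (expect_chaos_pow_le y hy ht ht8 hp) ?_)
    have := (sum_abs_chaosCoeff_le (κ := κ) y).trans
      (mul_le_mul_of_nonneg_left hD (Nat.cast_nonneg (Fintype.card κ)))
    gcongr
  have hbound : ∀ ω, |chaos y fun i => X i ω| ≤ Fintype.card κ * D := by
    intro ω
    rw [chaos_eq_sum y fun i => hX.eq_one_or_neg_one i ω]
    refine (abs_sum_le_sum_abs _ _).trans (le_trans (le_of_eq ?_)
      ((sum_abs_chaosCoeff_le (κ := κ) y).trans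
        (mul_le_mul_of_nonneg_left hD (Nat.cast_nonneg _))))
    refine sum_congr rfl fun q _ => ?_
    rw [abs_mul, abs_prod, prod_eq_one, mul_one]
    intro i _
    rcases hX.eq_one_or_neg_one i ω with h | h <;> rw [h] <;> norm_num
  have hint : Integrable (fun ω => (chaos y fun i => X i ω) ^ p) μ := by
    refine Integrable.of_bound (C := (Fintype.card κ * D) ^ p)
      ((measurable_chaos hX y).pow_const p).aestronglyMeasurable
      (Filter.Eventually.of_forall fun ω => ?_)
    rw [norm_pow, Real.norm_eq_abs]
    exact pow_le_pow_left₀ (abs_nonneg _) (hbound ω) p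
  have hmk := mul_meas_ge_le_integral_of_nonneg
    (Filter.Eventually.of_forall fun ω => hp.pow_nonneg _) hint (a ^ p)
  have hsub : μ.real {ω | a ≤ |chaos y fun i => X i ω|} ≤
      μ.real {ω | a ^ p ≤ (chaos y fun i => X i ω) ^ p} := by
    refine measureReal_mono fun ω hω => ?_
    rw [Set.mem_ofPred_eq, ← hp.pow_abs (chaos y _)]
    exact pow_le_pow_left₀ ha.le hω p
  have hap : 0 < a ^ p := pow_pos ha p
  calc _ ≤ ((p / t) ^ p * (2 * Real.exp (8 * t ^ 2 * Fintype.card κ)) +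
        ε * (Fintype.card κ * D) ^ p) / a ^ p := by
        rw [le_div_iff₀ hap, mul_comm]
        exact (mul_le_mul_of_nonneg_left hsub hap.le).trans (hmk.trans hmom)
    _ = _ := by
        rw [add_div, ← div_div, div_pow _ a, div_pow _ a]
        ring

end Chaos

/-! ### A sparse net for the restricted isometry property -/

section Net

open Finset

/-- A bound `t` for the quadratic form `Q x = ‖A x‖² - ‖x‖²` on a `1/8`-net of the unit ball of a
subspace yields the bound `2 t` on the whole ball. Indeed `Q x - Q y` is the value at
`(x - y, x + y)` of the bilinear form of `Q`, so the best constant `c` satisfies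
`c ≤ t + c / 4`. -/
lemma abs_norm_sq_sub_norm_sq_le_of_net {E F : Type*} [NormedAddCommGroup E]
    [InnerProductSpace ℝ E] [NormedAddCommGroup F] [InnerProductSpace ℝ F] (A : E →L[ℝ] F)
    (S : Submodule ℝ E) {t : ℝ} (ht : 0 ≤ t)
    (hnet : ∀ x ∈ S, ‖x‖ ≤ 1 → ∃ y ∈ S, ‖y‖ ≤ 1 ∧ ‖x - y‖ ≤ 1 / 8 ∧
      |‖A y‖ ^ 2 - ‖y‖ ^ 2| ≤ t) :
    ∀ x ∈ S, |‖A x‖ ^ 2 - ‖x‖ ^ 2| ≤ 2 * t * ‖x‖ ^ 2 := by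
  set Q : E → ℝ := fun x => ‖A x‖ ^ 2 - ‖x‖ ^ 2 with hQ
  have hQsmul : ∀ (c : ℝ) (x : E), Q (c • x) = c ^ 2 * Q x := by
    intro c x
    simp only [hQ, map_smul, norm_smul, mul_pow, Real.norm_eq_abs, sq_abs]
    ring
  -- The factors `4` and `1 / 4` balance `‖x - y‖ ≤ 1 / 8` against `‖x + y‖ ≤ 2`.
  have hpol : ∀ x y : E, Q x - Q y =
      1 / 4 * (Q ((4 : ℝ) • (x - y) + (1 / 4 : ℝ) • (x + y)) -
        Q ((4 : ℝ) • (x - y) - (1 / 4 : ℝ) • (x + y))) := by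
    intro x y
    simp only [hQ, map_add, map_sub, map_smul, ← real_inner_self_eq_norm_sq, inner_add_left,
      inner_add_right, inner_sub_left, inner_sub_right, real_inner_smul_left,
      real_inner_smul_right, real_inner_comm x y, real_inner_comm (A x) (A y)]
    ring
  -- The best constant `c₀ = inf C` is itself admissible.
  set C : Set ℝ := {c | 0 ≤ c ∧ ∀ x ∈ S, |Q x| ≤ c * ‖x‖ ^ 2} with hC
  have hCne : C.Nonempty := by
    refine ⟨‖A‖ ^ 2 + 1, by positivity, fun x _ => ?_⟩
    have h1 : ‖A x‖ ^ 2 ≤ ‖A‖ ^ 2 * ‖x‖ ^ 2 := by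
      rw [← mul_pow]; exact pow_le_pow_left₀ (norm_nonneg _) (A.le_opNorm x) 2
    rw [abs_le]
    constructor <;> simp only [hQ] <;> nlinarith [sq_nonneg ‖A x‖, sq_nonneg ‖x‖,
      mul_nonneg (sq_nonneg ‖A‖) (sq_nonneg ‖x‖)]
  have hCbdd : BddBelow C := ⟨0, fun c hc => hc.1⟩
  set c₀ := sInf C
  have hc₀ : 0 ≤ c₀ := le_csInf hCne fun c hc => hc.1
  have hmem : ∀ x ∈ S, |Q x| ≤ c₀ * ‖x‖ ^ 2 := by
    intro x hx
    rcases (sq_nonneg ‖x‖).eq_or_lt with h0 | h0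
    · obtain ⟨c, hc⟩ := hCne
      have := hc.2 x hx
      rwa [← h0, mul_zero] at this ⊢
    · rw [← div_le_iff₀ h0]
      exact le_csInf hCne fun c hc => (div_le_iff₀ h0).2 (hc.2 x hx)
  have hball : ∀ x ∈ S, ‖x‖ ≤ 1 → |Q x| ≤ t + c₀ / 4 := by
    intro x hx hx1
    obtain ⟨y, hy, hy1, hxy, hQy⟩ := hnet x hx hx1
    set u := (4 : ℝ) • (x - y) with hu
    set v := (1 / 4 : ℝ) • (x + y) with hv
    have huS : u ∈ S := S.smul_mem _ (S.sub_mem hx hy)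
    have hvS : v ∈ S := S.smul_mem _ (S.add_mem hx hy)
    have hun : ‖u‖ ≤ 1 / 2 := by
      rw [hu, norm_smul, Real.norm_of_nonneg (by norm_num)]; linarith
    have hvn : ‖v‖ ≤ 1 / 2 := by
      rw [hv, norm_smul, Real.norm_of_nonneg (by norm_num)]; linarith [norm_add_le x y]
    have hpar : ‖u + v‖ ^ 2 + ‖u - v‖ ^ 2 ≤ 1 := by
      have := parallelogram_law_with_norm ℝ u v
      nlinarith [norm_nonneg u, norm_nonneg v]
    have h1 := hmem _ (S.add_mem huS hvS)
    have h2 := hmem _ (S.sub_mem huS hvS)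
    have h3 : |Q x - Q y| ≤ c₀ / 4 := by
      rw [hpol x y, abs_mul, abs_of_pos (by norm_num : (0 : ℝ) < 1 / 4)]
      have := abs_sub (Q (u + v)) (Q (u - v))
      have := mul_le_mul_of_nonneg_left hpar hc₀
      linarith
    have := abs_sub_abs_le_abs_sub (Q x) (Q y)
    linarith
  have hc₀le : c₀ ≤ t + c₀ / 4 := by
    refine csInf_le hCbdd ⟨by positivity, fun x hx => ?_⟩
    rcases eq_or_ne x 0 with rfl | h0
    · simp [hQ]
    · have hn : 0 < ‖x‖ := norm_pos_iff.2 h0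
      have h := hball (‖x‖⁻¹ • x) (S.smul_mem _ hx) (by
        rw [norm_smul, norm_inv, norm_norm, inv_mul_cancel₀ hn.ne'])
      rw [hQsmul, abs_mul, abs_of_nonneg (by positivity), inv_pow, inv_mul_le_iff₀ (by positivity)]
        at h
      linarith
  intro x hx
  refine (hmem x hx).trans ?_
  gcongr
  linarith

lemma exists_int_abs_le_abs_sub_le (r : ℝ) : ∃ z : ℤ, |(z : ℝ)| ≤ |r| ∧ |r - z| ≤ 1 := by
  rcases le_total 0 r with h | h
  · have h0 : (0 : ℝ) ≤ ⌊r⌋ := by exact_mod_cast Int.floor_nonneg.2 h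
    refine ⟨⌊r⌋, ?_, ?_⟩
    · rw [abs_of_nonneg h0, abs_of_nonneg h]; exact Int.floor_le r
    · rw [abs_le]; constructor <;> linarith [Int.floor_le r, Int.lt_floor_add_one r]
  · have h0 : (⌈r⌉ : ℝ) ≤ 0 := by exact_mod_cast Int.ceil_nonpos.2 h
    refine ⟨⌈r⌉, ?_, ?_⟩
    · rw [abs_of_nonpos h0, abs_of_nonpos h]; linarith [Int.le_ceil r]
    · rw [abs_le]; constructor <;> linarith [Int.le_ceil r, Int.ceil_lt_add_one r]

/-- The integer vectors `z` with at most `k` nonzero entries for which `z / N` lies in the unit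
ball of `ℝ^N`. -/
noncomputable def sparseGrid (N k : ℕ) : Finset (Fin N → ℤ) :=
  {z ∈ Fintype.piFinset fun _ => Icc (-(N : ℤ)) N |
    #{i | z i ≠ 0} ≤ k ∧ ∑ i, (z i) ^ 2 ≤ (N : ℤ) ^ 2}

/-- A `k`-sparse vector is determined by a map `Fin k → Fin N` whose range contains its support,
together with its values there. -/
lemma card_sparseGrid_le {N : ℕ} (hN : 0 < N) (k : ℕ) :
    #(sparseGrid N k) ≤ (N * (2 * N + 1)) ^ k := by
  classical
  set V := (Icc (-(N : ℤ)) N) with hV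
  set D : (Fin k → Fin N) × (Fin k → V) → Fin N → ℤ := fun f n =>
    if h : ∃ j, f.1 j = n then (f.2 h.choose : ℤ) else 0 with hD
  have hsub : sparseGrid N k ⊆ univ.image D := by
    intro z hz
    obtain ⟨hzV, hzk, -⟩ := by simpa only [sparseGrid, mem_filter, Fintype.mem_piFinset] using hz
    have hcard : Fintype.card {i // z i ≠ 0} ≤ Fintype.card (Fin k) := by
      rwa [Fintype.card_subtype, Fintype.card_fin]
    obtain ⟨e⟩ := Function.Embedding.nonempty_of_card_le hcard
    set g : Fin k → Fin N := Function.extend e Subtype.val fun _ => ⟨0, hN⟩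
    refine mem_image.2 ⟨(g, fun j => ⟨z (g j), hzV _⟩), mem_univ _, ?_⟩
    funext n
    simp only [hD]
    split_ifs with h
    · rw [h.choose_spec]
    · by_contra hne
      exact h ⟨e ⟨n, Ne.symm hne⟩, e.injective.extend_apply _ _ _⟩
  refine (card_le_card hsub).trans (card_image_le.trans (le_of_eq ?_))
  have hcV : Fintype.card V = 2 * N + 1 := by
    rw [Fintype.card_coe, hV, Int.card_Icc]; omega
  rw [card_univ, Fintype.card_prod, Fintype.card_fun, Fintype.card_fun, hcV]
  simp [mul_pow]

/-- It suffices to control `‖Φ y‖² - ‖y‖²` on the grid of sparse vectors `y = z / N`: rounding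
the coordinates of a vector towards zero keeps its support and does not increase its norm. -/
lemma hasRIP_of_sparseGrid {M N k : ℕ} (hN : 64 ≤ N) (Φ : Matrix (Fin M) (Fin N) ℝ) {δ : ℝ}
    (hδ : 0 ≤ δ)
    (h : ∀ z ∈ sparseGrid N k, |∑ m, (Φ.mulVec (fun n => (z n : ℝ) / N) m) ^ 2 -
      ∑ n, ((z n : ℝ) / N) ^ 2| ≤ δ / 2) :
    HasRIP Φ k δ := by
  classical
  have hN0 : (0 : ℝ) < N := by exact_mod_cast (by omega : 0 < N)
  intro x hx
  set A := LinearMap.toContinuousLinearMap (Matrix.toEuclideanLin Φ) with hA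
  have hAx : ∀ w : EuclideanSpace ℝ (Fin N), A w = WithLp.toLp 2 (Φ.mulVec w.ofLp) := fun w => rfl
  let S : Submodule ℝ (EuclideanSpace ℝ (Fin N)) :=
    { carrier := {w | ∀ n, x n = 0 → w n = 0}
      add_mem' := fun {a b} ha hb n hn => by simp [ha n hn, hb n hn]
      zero_mem' := fun n _ => rfl
      smul_mem' := fun c a ha n hn => by simp [ha n hn] }
  have hmain := abs_norm_sq_sub_norm_sq_le_of_net A S (t := δ / 2) (by positivity) ?_ x
    (fun n hn => hn)
  · rw [abs_le, hAx] at hmain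
    constructor <;> linarith [hmain.1, hmain.2]
  · intro w hw hw1
    choose z hz1 hz2 using fun n => exists_int_abs_le_abs_sub_le (N * w n)
    have hzN : ∀ n, |(z n : ℝ) / N| ≤ |w n| := by
      intro n
      rw [abs_div, abs_of_pos hN0, div_le_iff₀ hN0]
      refine (hz1 n).trans (le_of_eq ?_)
      rw [abs_mul, abs_of_pos hN0, mul_comm]
    have hw2 : ∑ n, w n ^ 2 ≤ 1 := by
      rw [← EuclideanSpace.real_norm_sq_eq]; exact pow_le_one₀ (norm_nonneg _) hw1
    have hsum : ∑ n, ((z n : ℝ) / N) ^ 2 ≤ 1 :=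
      (sum_le_sum fun n _ => sq_le_sq.2 (hzN n)).trans hw2
    have hzsupp : ∀ n, x n = 0 → z n = 0 := by
      intro n hn
      have := hz1 n
      rw [hw n hn, mul_zero, abs_zero] at this
      exact_mod_cast abs_nonpos_iff.1 this
    have hzmem : z ∈ sparseGrid N k := by
      have hsq : ∑ n, (z n) ^ 2 ≤ (N : ℤ) ^ 2 := by
        simp_rw [div_pow, ← sum_div] at hsum
        rw [div_le_one (by positivity)] at hsum
        exact_mod_cast hsum
      simp only [sparseGrid, mem_filter, Fintype.mem_piFinset, mem_Icc]
      refine ⟨fun n => abs_le.1 (abs_le_of_sq_le_sq ((single_le_sum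
        (fun i _ => sq_nonneg (z i)) (mem_univ n)).trans hsq) (by positivity)), ?_, hsq⟩
      refine le_trans ?_ hx
      rw [← Set.ncard_coe_finset]
      refine Set.ncard_le_ncard (fun n hn => ?_) (Set.toFinite _)
      simp only [coe_filter, mem_univ, true_and, Set.mem_ofPred_eq] at hn ⊢
      exact fun h0 => hn (hzsupp n h0)
    refine ⟨WithLp.toLp 2 fun n => (z n : ℝ) / N, fun n hn => by simp [hzsupp n hn], ?_, ?_, ?_⟩
    · rw [← sq_le_one_iff₀ (norm_nonneg _), EuclideanSpace.real_norm_sq_eq]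
      exact hsum
    · refine abs_le_of_sq_le_sq' ?_ (by norm_num) |>.2
      rw [EuclideanSpace.real_norm_sq_eq]
      calc ∑ n, (w - WithLp.toLp 2 fun n => (z n : ℝ) / N) n ^ 2
          ≤ ∑ _n : Fin N, (1 / (N : ℝ)) ^ 2 := by
            refine sum_le_sum fun n _ => sq_le_sq.2 ?_
            have h1 : (w - WithLp.toLp 2 fun n => (z n : ℝ) / N) n = (N * w n - z n) / N := by
              simp only [PiLp.sub_apply]; field_simp
            rw [h1, abs_div, abs_of_pos hN0, abs_of_pos (by positivity : (0 : ℝ) < 1 / N)]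
            gcongr
            exact hz2 n
        _ = 1 / N := by
            rw [sum_const, card_univ, Fintype.card_fin, nsmul_eq_mul]; field_simp
        _ ≤ 1 / 64 := by
            gcongr; exact_mod_cast hN
        _ = _ := by norm_num
    · rw [hAx, EuclideanSpace.real_norm_sq_eq, EuclideanSpace.real_norm_sq_eq]
      exact h z hzmem

end Net

/-! ### Choice of parameters and union bound -/

section Parameters

/-- With `p ≈ 10 K log N` and `t = 6 p / (δ M)`, the two terms of the moment bound for a single
grid vector are at most `2 N ^ (-9 K)` and `N ^ (-9 K)`. Here `L` stands for `log N`. -/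
lemma moment_bound_le {K L δ M ε ℓ : ℝ} (hK : 2 ≤ K) (hL : 1 ≤ L) (hδ : 0 < δ)
    (hδ1 : δ ≤ 1) (hM : 5760000 / δ ^ 2 * K * Real.log K ^ 2 * L ≤ M)
    (hℓ : ℓ = Real.log (150 / δ * K * Real.log K)) (hε : ε ≤ Real.exp (-40 * K * ℓ * L)) {p : ℕ}
    (hp1 : 10 * (K * L) ≤ p) (hp2 : p ≤ 12 * (K * L)) :
    0 < 6 * p / (δ * M) ∧ 6 * p / (δ * M) ≤ 1 / 8 ∧
      (p / (6 * p / (δ * M) * (M * δ / 2))) ^ p *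
          (2 * Real.exp (8 * (6 * p / (δ * M)) ^ 2 * M)) +
        ε * (M * (2 * K) / (M * δ / 2)) ^ p ≤ 3 * Real.exp (-9 * (K * L)) := by
  have hlogK : 0.69 ≤ Real.log K :=
    (by linarith [Real.log_two_gt_d9] : (0.69 : ℝ) ≤ Real.log 2).trans
      (Real.log_le_log (by norm_num) hK)
  have hKL : 2 ≤ K * L := by nlinarith
  have hp0 : (0 : ℝ) < p := by linarith
  -- `2700000 < 5760000 (log 2)²`
  have hM' : 2700000 * (K * L) ≤ δ ^ 2 * M := by
    have h1 : δ ^ 2 * (5760000 / δ ^ 2 * K * Real.log K ^ 2 * L) =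
        5760000 * Real.log K ^ 2 * (K * L) := by field_simp
    have h2 := mul_le_mul_of_nonneg_left hM (sq_nonneg δ)
    rw [h1] at h2
    refine le_trans ?_ h2
    gcongr
    nlinarith
  have hM0 : 0 < M := by
    by_contra h
    nlinarith [mul_nonneg (sq_nonneg δ) (neg_nonneg.2 (not_lt.1 h))]
  have hδM : δ ^ 2 * M ≤ δ * M := by nlinarith [mul_pos hδ hM0]
  refine ⟨by positivity, ?_, ?_⟩
  · rw [div_le_iff₀ (by positivity)]
    linarith
  have e1 : (p : ℝ) / (6 * p / (δ * M) * (M * δ / 2)) = 1 / 3 := by field_simp; norm_num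
  have e2 : M * (2 * K) / (M * δ / 2) = 4 * K / δ := by field_simp; norm_num
  have e3 : 8 * (6 * p / (δ * M)) ^ 2 * M = 288 * (p : ℝ) ^ 2 / (δ ^ 2 * M) := by
    field_simp; norm_num
  have hexp : 288 * (p : ℝ) ^ 2 / (δ ^ 2 * M) ≤ K * L := by
    rw [div_le_iff₀ (by positivity)]
    have h1 : (p : ℝ) ^ 2 ≤ (12 * (K * L)) ^ 2 := pow_le_pow_left₀ hp0.le hp2 2
    nlinarith [mul_le_mul_of_nonneg_left hM' (by positivity : 0 ≤ K * L)]
  have hthird : (1 / 3 : ℝ) ^ p ≤ Real.exp (-10 * (K * L)) := by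
    have h1 : (1 / 3 : ℝ) ≤ Real.exp (-1) := by
      rw [Real.exp_neg, ← one_div]
      exact one_div_le_one_div_of_le (Real.exp_pos 1) (by linarith [Real.exp_one_lt_d9])
    calc (1 / 3 : ℝ) ^ p ≤ Real.exp (-1) ^ p := by gcongr
      _ = Real.exp (p * -1) := (Real.exp_nat_mul _ _).symm
      _ ≤ _ := Real.exp_le_exp.2 (by linarith)
  have harg : 4 * K / δ ≤ 150 / δ * K * Real.log K := by
    rw [div_le_iff₀ hδ]
    have : 150 / δ * K * Real.log K * δ = 150 * K * Real.log K := by field_simp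
    rw [this]; nlinarith
  have h4 : 4 ≤ 4 * K / δ := by
    rw [le_div_iff₀ hδ]; linarith
  have hℓ1 : Real.log (4 * K / δ) ≤ ℓ := hℓ ▸ Real.log_le_log (by linarith) harg
  have hℓ2 : 1 ≤ ℓ := by
    refine le_trans ?_ hℓ1
    rw [Real.le_log_iff_exp_le (by linarith)]
    linarith [Real.exp_one_lt_d9]
  have hbias : ε * (4 * K / δ) ^ p ≤ Real.exp (-9 * (K * L)) := by
    calc ε * (4 * K / δ) ^ p
        ≤ Real.exp (-40 * K * ℓ * L) * Real.exp (p * Real.log (4 * K / δ)) := by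
          rw [Real.exp_nat_mul, Real.exp_log (by linarith)]
          gcongr
      _ = Real.exp (-40 * K * ℓ * L + p * Real.log (4 * K / δ)) := (Real.exp_add _ _).symm
      _ ≤ _ := by
          refine Real.exp_le_exp.2 ?_
          have h1 : p * Real.log (4 * K / δ) ≤ 12 * (K * L) * ℓ :=
            mul_le_mul hp2 hℓ1 (Real.log_nonneg (by linarith)) (by positivity)
          nlinarith [mul_le_mul_of_nonneg_left hℓ2 (by positivity : 0 ≤ K * L)]
  rw [e1, e2, e3]
  have hfirst : (1 / 3 : ℝ) ^ p * (2 * Real.exp (288 * (p : ℝ) ^ 2 / (δ ^ 2 * M))) ≤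
      2 * Real.exp (-9 * (K * L)) := by
    calc _ ≤ Real.exp (-10 * (K * L)) * (2 * Real.exp (K * L)) := by gcongr
      _ = 2 * (Real.exp (-10 * (K * L)) * Real.exp (K * L)) := by ring
      _ = _ := by rw [← Real.exp_add]; congr 2; ring
  linarith

lemma card_sparseGrid_mul_le {N K : ℕ} (hN : 64 ≤ N) (hKL : 1 ≤ K * Real.log N) :
    ((sparseGrid N (2 * K)).card : ℝ) * (3 * Real.exp (-9 * (K * Real.log N))) ≤
      2 * (N : ℝ) ^ (-2 * (K : ℝ)) := by
  have hN0 : (0 : ℝ) < N := by exact_mod_cast (by omega : 0 < N)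
  have hcard : ((sparseGrid N (2 * K)).card : ℝ) ≤ Real.exp (6 * (K * Real.log N)) := by
    have h1 : N * (2 * N + 1) ≤ N ^ 3 := by
      rw [show N ^ 3 = N * (N * N) by ring]
      gcongr
      nlinarith
    have h2 : (sparseGrid N (2 * K)).card ≤ N ^ (6 * K) :=
      (card_sparseGrid_le (by omega) _).trans
        ((Nat.pow_le_pow_left h1 _).trans (le_of_eq (by rw [← pow_mul]; congr 1; ring)))
    calc ((sparseGrid N (2 * K)).card : ℝ) ≤ (N : ℝ) ^ (6 * K) := by exact_mod_cast h2
      _ = Real.exp ((6 * K : ℕ) * Real.log N) := by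
          rw [Real.exp_nat_mul, Real.exp_log hN0]
      _ = _ := by congr 1; push_cast; ring
  have hhalf : Real.exp (-(K * Real.log N)) ≤ 1 / 2 := by
    rw [Real.exp_neg, ← one_div]
    exact one_div_le_one_div_of_le (by norm_num)
      (by linarith [Real.add_one_le_exp (K * Real.log N)])
  rw [Real.rpow_def_of_pos hN0]
  calc _ ≤ Real.exp (6 * (K * Real.log N)) * (3 * Real.exp (-9 * (K * Real.log N))) := by gcongr
    _ = 3 * Real.exp (-(K * Real.log N)) * Real.exp (Real.log N * (-2 * K)) := by
        rw [mul_left_comm, ← Real.exp_add, mul_assoc, ← Real.exp_add]; congr 2; ring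
    _ ≤ _ := by
        gcongr
        linarith

end Parameters

section Union

open Finset

lemma sum_mulVec_scaledMatrix_sq_sub {Ω : Type*} {M N : ℕ} (hM : 0 < M)
    (X : Fin M × Fin N → Ω → ℝ) (ω : Ω) (y : Fin N → ℝ) :
    ∑ m, ((scaledMatrix X ω).mulVec y m) ^ 2 - ∑ n, y n ^ 2 =
      (chaos y fun i => X i ω) / M := by
  have hM0 : (0 : ℝ) < M := by exact_mod_cast hM
  have h : ∀ m, (scaledMatrix X ω).mulVec y m ^ 2 = (∑ n, y n * X (m, n) ω) ^ 2 / M := by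
    intro m
    have : (scaledMatrix X ω).mulVec y m = (∑ n, y n * X (m, n) ω) / √M := by
      simp only [scaledMatrix, Matrix.mulVec, dotProduct, Matrix.of_apply]
      rw [sum_div]
      exact sum_congr rfl fun n _ => by ring
    rw [this, div_pow, Real.sq_sqrt hM0.le]
  simp_rw [h, chaos, sum_sub_distrib, ← sum_div]
  rw [sum_const, card_univ, Fintype.card_fin, nsmul_eq_mul, sub_div, mul_div_cancel_left₀ _ hM0.ne']

/-- The points `y = z / N` of the grid satisfy `‖y‖₂ ≤ 1` and, by sparsity, `‖y‖₁² ≤ k`. -/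
lemma sum_sq_le_and_sq_sum_abs_le {N k : ℕ} (hN : 0 < N) {z : Fin N → ℤ}
    (hz : z ∈ sparseGrid N k) :
    ∑ n, ((z n : ℝ) / N) ^ 2 ≤ 1 ∧ (∑ n, |(z n : ℝ) / N|) ^ 2 ≤ k := by
  have hN0 : (0 : ℝ) < N := by exact_mod_cast hN
  obtain ⟨-, hzk, hzs⟩ := by simpa only [sparseGrid, mem_filter] using hz
  have h1 : ∑ n, ((z n : ℝ) / N) ^ 2 ≤ 1 := by
    simp_rw [div_pow, ← sum_div]
    rw [div_le_one (by positivity)]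
    exact_mod_cast hzs
  refine ⟨h1, ?_⟩
  have h2 : ∑ n, |(z n : ℝ) / N| = ∑ n with z n ≠ 0, |(z n : ℝ) / N| := by
    refine (sum_filter_of_ne fun n _ hn => ?_).symm
    contrapose! hn
    simp [hn]
  rw [h2]
  refine sq_sum_le_card_mul_sum_sq.trans ?_
  have h3 : ∑ n with z n ≠ 0, |(z n : ℝ) / N| ^ 2 ≤ 1 := by
    simp_rw [sq_abs]
    exact (sum_le_sum_of_subset_of_nonneg (filter_subset _ _) fun _ _ _ => sq_nonneg _).trans h1
  calc _ ≤ (#{n | z n ≠ 0} : ℝ) * 1 := by gcongr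
    _ ≤ k := by rw [mul_one]; exact_mod_cast hzk

end Union

theorem mainTheorem2 :
    ∃ N₀ : ℕ, ∀ N : ℕ, N₀ ≤ N → ∀ K : ℕ, 2 ≤ K → ∀ δ : ℝ, 0 < δ → δ ≤ 1 →
      ∀ M : ℕ, M = ⌈5760000 / δ ^ 2 * K * Real.log K ^ 2 * Real.log N⌉₊ →
      ∀ ε : ℝ, ε ≤ Real.exp (-40 * K * Real.log (150 / δ * K * Real.log K) * Real.log N) →
      ∀ (Ω : Type*) [MeasurableSpace Ω] (μ : Measure Ω) [IsProbabilityMeasure μ]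
        (X : Fin M × Fin N → Ω → ℝ), IsBernoulliFamily X → IsBiased μ ε X →
        1 - 2 * (N : ℝ) ^ (-2 * (K : ℝ)) ≤
          μ.real {ω | HasRIP (scaledMatrix X ω) (2 * K) δ} := by
  refine ⟨64, fun N hN K hK δ hδ hδ1 M hM ε hε Ω _ μ _ X hX hb => ?_⟩
  have hN' : (64 : ℝ) ≤ N := by exact_mod_cast hN
  have hK' : (2 : ℝ) ≤ K := by exact_mod_cast hK
  have hL : 1 ≤ Real.log N := by
    rw [Real.le_log_iff_exp_le (by linarith)]
    linarith [Real.exp_one_lt_d9]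
  have hKL : 2 ≤ K * Real.log N := by nlinarith
  have hMle : 5760000 / δ ^ 2 * K * Real.log K ^ 2 * Real.log N ≤ M := hM ▸ Nat.le_ceil _
  have hMpos : 0 < M := by
    have : 0 < Real.log K := Real.log_pos (by linarith)
    rw [hM, Nat.ceil_pos]
    positivity
  have hM0 : (0 : ℝ) < M := by exact_mod_cast hMpos
  have hε0 : 0 ≤ ε :=
    (abs_nonneg _).trans (hb _ (Finset.singleton_nonempty (⟨0, hMpos⟩, ⟨0, by omega⟩)))
  set p : ℕ := 2 * ⌈5 * (K * Real.log N)⌉₊ with hp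
  have hp1 : 10 * (K * Real.log N) ≤ p := by
    rw [hp]; push_cast; linarith [Nat.le_ceil (5 * (K * Real.log N))]
  have hp2 : p ≤ 12 * (K * Real.log N) := by
    rw [hp]; push_cast
    linarith [Nat.ceil_lt_add_one (by positivity : 0 ≤ 5 * (K * Real.log N))]
  have hpe : Even p := even_two_mul _
  obtain ⟨ht, ht8, hbd⟩ := moment_bound_le hK' hL hδ hδ1 hMle rfl hε hp1 hp2
  set bad : (Fin N → ℤ) → Set Ω := fun z =>
    {ω | M * δ / 2 ≤ |chaos (fun n => (z n : ℝ) / N) fun i => X i ω|} with hbad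
  have hprob : ∀ z ∈ sparseGrid N (2 * K),
      μ.real (bad z) ≤ 3 * Real.exp (-9 * (K * Real.log N)) := by
    intro z hz
    obtain ⟨hz1, hz2⟩ := sum_sq_le_and_sq_sum_abs_le (by omega) hz
    refine (measureReal_le_abs_chaos_le hX hε0 hb _ hz1 ht ht8 hpe hz2
      (by positivity)).trans ?_
    simpa only [Fintype.card_fin, Nat.cast_mul, Nat.cast_ofNat] using hbd
  have hmeas : MeasurableSet (⋃ z ∈ sparseGrid N (2 * K), bad z) :=
    Finset.measurableSet_biUnion _ fun z _ =>
      measurableSet_le measurable_const (measurable_chaos hX _).abs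
  have hunion : μ.real (⋃ z ∈ sparseGrid N (2 * K), bad z) ≤ 2 * (N : ℝ) ^ (-2 * (K : ℝ)) := by
    refine (measureReal_biUnion_finset_le _ _).trans ((Finset.sum_le_sum hprob).trans ?_)
    rw [Finset.sum_const, nsmul_eq_mul]
    exact card_sparseGrid_mul_le hN (by linarith)
  have hgood : (⋃ z ∈ sparseGrid N (2 * K), bad z)ᶜ ⊆
      {ω | HasRIP (scaledMatrix X ω) (2 * K) δ} := by
    intro ω hω
    refine hasRIP_of_sparseGrid hN _ hδ.le fun z hz => ?_
    rw [sum_mulVec_scaledMatrix_sq_sub hMpos, abs_div, abs_of_pos hM0, div_le_iff₀ hM0]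
    have hz' : ω ∉ bad z := fun h => hω (Set.mem_biUnion hz h)
    have hlt : |chaos (fun n => (z n : ℝ) / N) fun i => X i ω| < M * δ / 2 := not_le.1 hz'
    linarith
  calc 1 - 2 * (N : ℝ) ^ (-2 * (K : ℝ))
      ≤ μ.real (⋃ z ∈ sparseGrid N (2 * K), bad z)ᶜ := by
        rw [probReal_compl_eq_one_sub hmeas]; linarith
    _ ≤ _ := measureReal_mono hgood
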